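/- Let $n\ge 0$ be an integer and $\eta,\alpha\in\mathbb C$. Consider the $(4n+1)$-dimensional complex space with coordinates $A_0,\dots,A_{2n},B_1,\dots,B_n,C_1,\dots,C_n$, the algebra $R$ of polynomial functions on it, and the generating functions $$A(\lambda)=\alpha\lambda^{2n+1}+\sum_{i=0}^{2n}A_i\lambda^i,\qquad B(\lambda)=\lambda^{2n+1}+\sum_{i=1}^{n}B_i\lambda^{2i-1},\qquad C(\lambda)=\sum_{i=1}^{n}C_i\lambda^{2i-1},$$ $$T(\lambda)=\begin{pmatrix}A(\lambda)&B(\lambda)\\ C(\lambda)&A(-\lambda)\end{pmatrix}.$$ For $k=0,1$ let $\rho_k(\lambda)$ be the polynomial quotient of $\lambda^{2k-1}A(\lambda)$ by $B(\lambda)$ (equivalently, of $\lambda^{2k}A(\lambda)$ by the monic polynomial $\lambda B(\lambda)$). Then $\rho_0=0$ and $\rho_1(\lambda)=\alpha\lambda+A_{2n}$, and the following holds. (1) For each $k=0,1$ there is exactly one skew-symmetric $\mathbb C$-bilinear biderivation $\{\cdot,\cdot\}_k$ of $R$ such that for all $\lambda,\mu\in\mathbb C$ with $\lambda\ne\pm\mu$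 $$\{B(\lambda),B(\mu)\}_k=0,$$ $$\{A(\lambda),A(\mu)\}_k=\tfrac{\eta}{\lambda+\mu}\bigl(\mu^{2k}B(\lambda)C(\mu)-\lambda^{2k}B(\mu)C(\lambda)\bigr),$$ $$\{C(\lambda),C(\mu)\}_k=2\eta\bigl(\rho_k(-\mu)A(\mu)-\rho_k(\mu)A(-\mu)\bigr)C(\lambda)-2\eta\bigl(\rho_k(-\lambda)A(\lambda)-\rho_k(\lambda)A(-\lambda)\bigr)C(\mu),$$ $$\{A(\lambda),B(\mu)\}_k=\tfrac{\eta}{\lambda-\mu}\bigl(\lambda^{2k}A(\lambda)B(\mu)-\mu^{2k}A(\mu)B(\lambda)\bigr)+\tfrac{\eta}{\lambda+\mu}\bigl(\lambda^{2k}A(\lambda)B(\mu)+\mu^{2k}A(-\mu)B(\lambda)\bigr)-2\eta\rho_k(\lambda)B(\lambda)B(\mu),$$ $$\{A(\lambda),C(\mu)\}_k=-\tfrac{\eta}{\lambda-\mu}\bigl(\mu^{2k}A(\lambda)C(\mu)-\lambda^{2k}A(\mu)C(\lambda)\bigr)-2\eta k\lambda A(\lambda)C(\mu)-\tfrac{\eta}{\lambda+\mu}\bigl(\mu^{2k}A(\lambda)C(\mu)+\lambda^{2k}A(-\mu)C(\lambda)\bigr)+2\eta\rho_k(\lambda)B(\lambda)C(\mu),$$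 $$\{B(\lambda),C(\mu)\}_k=\tfrac{\eta\lambda^{2k}}{\lambda-\mu}\bigl(A(-\lambda)A(\mu)-A(\lambda)A(-\mu)\bigr)+\tfrac{\eta\lambda^{2k}}{\lambda+\mu}\bigl(A(\lambda)A(\mu)-A(-\lambda)A(-\mu)\bigr)+2\eta\bigl(\rho_k(\mu)A(-\mu)-\rho_k(-\mu)A(\mu)\bigr)B(\lambda).$$ (2) Both $\{\cdot,\cdot\}_0$ and $\{\cdot,\cdot\}_1$ are Poisson brackets, i.e. they satisfy the Jacobi identity. (3) $\{\cdot,\cdot\}_0$ is the bracket of the rational reflection equation algebra: it is the unique skew-symmetric $\mathbb C$-bilinear biderivation of $R$ such that for all $\lambda,\mu\in\mathbb C$ with $\lambda\neq\pm\mu$ $$\{T_1(\lambda),T_2(\mu)\}_0=[r(\lambda-\mu),T_1(\lambda)T_2(\mu)]+T_1(\lambda)r(\lambda+\mu)T_2(\mu)-T_2(\mu)r(\lambda+\mu)T_1(\lambda),$$ where $T_1(\lambda)=T(\lambda)\otimes I$, $T_2(\mu)=I\otimes T(\mu)$, $r(\lambda)=\frac{\eta}{\lambda}\Pi$, and $\Pi$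 is the permutation matrix of $\mathbb C^2\otimes\mathbb C^2$. (4) The two brackets are compatible: $c_0\{\cdot,\cdot\}_0+c_1\{\cdot,\cdot\}_1$ is a Poisson bracket for all $c_0,c_1\in\mathbb C$. -/

import Mathlib

noncomputable section

open Polynomial
open scoped Kronecker

/-! ### Poisson brackets on a commutative algebra -/

/-- A skew-symmetric bilinear bracket which is a derivation in its second
(hence, by skew-symmetry, in each) argument. -/
structure IsSkewBiderivation {R : Type*} [CommRing R] [Algebra ℂ R]
    (b : R →ₗ[ℂ] R →ₗ[ℂ] R) : Prop where
  skew : ∀ f g : R, b f g = -b g f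
  leibniz : ∀ f g h : R, b f (g * h) = b f g * h + g * b f h

/-- A Poisson bracket: a skew-symmetric biderivation satisfying the Jacobi identity. -/
structure IsPoissonBracket {R : Type*} [CommRing R] [Algebra ℂ R]
    (b : R →ₗ[ℂ] R →ₗ[ℂ] R) : Prop extends IsSkewBiderivation b where
  jacobi : ∀ f g h : R, b f (b g h) + b g (b h f) + b h (b f g) = 0

/-- Two brackets are compatible if every linear combination of them is a Poisson bracket. -/
def AreCompatible {R : Type*} [CommRing R] [Algebra ℂ R]
    (b b' : R →ₗ[ℂ] R →ₗ[ℂ] R) : Prop :=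
  ∀ c c' : ℂ, IsPoissonBracket (c • b + c' • b')

namespace ReflectionAlgebra

/-! ### The space of coefficients and the matrix `T` -/

/-- The coordinates on the `4n+1`-dimensional space of coefficients:
`A i` is `A_i` for `0 ≤ i ≤ 2n`, while `B i`, `C i` are `B_{i+1}`, `C_{i+1}` for `0 ≤ i < n`. -/
inductive Gen (n : ℕ) : Type
  | A (i : Fin (2 * n + 1)) : Gen n
  | B (i : Fin n) : Gen n
  | C (i : Fin n) : Gen n

/-- The algebra of polynomial functions on the space of coefficients. -/
abbrev Coeffs (n : ℕ) : Type := MvPolynomial (Gen n) ℂ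

/-- `A(λ) = α λ^(2n+1) + A_{2n} λ^(2n) + ⋯ + A_0`; the leading coefficient `α` is a number. -/
def polyA (n : ℕ) (α : ℂ) : (Coeffs n)[X] :=
  C (MvPolynomial.C α) * X ^ (2 * n + 1)
    + ∑ i : Fin (2 * n + 1), C (MvPolynomial.X (Gen.A i)) * X ^ (i : ℕ)

/-- `B(λ) = λ^(2n+1) + B_n λ^(2n-1) + ⋯ + B_1 λ`. -/
def polyB (n : ℕ) : (Coeffs n)[X] :=
  X ^ (2 * n + 1) + ∑ i : Fin n, C (MvPolynomial.X (Gen.B i)) * X ^ (2 * (i : ℕ) + 1)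

/-- `C(λ) = C_n λ^(2n-1) + ⋯ + C_1 λ`. -/
def polyC (n : ℕ) : (Coeffs n)[X] :=
  ∑ i : Fin n, C (MvPolynomial.X (Gen.C i)) * X ^ (2 * (i : ℕ) + 1)

/-- `ρ_k(λ)`, the polynomial quotient of `λ^(2k-1) A(λ)` by `B(λ)`. To avoid the negative
power at `k = 0` numerator and denominator are multiplied by `λ`; note that `λ B(λ)` is monic. -/
def polyRho (n : ℕ) (α : ℂ) (k : ℕ) : (Coeffs n)[X] :=
  (X ^ (2 * k) * polyA n α) /ₘ (X * polyB n)

/-- The value of a polynomial with coefficients in `Coeffs n` at a complex number. -/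
def at' {n : ℕ} (p : (Coeffs n)[X]) (x : ℂ) : Coeffs n :=
  p.eval (algebraMap ℂ (Coeffs n) x)

/-- The matrix `T(λ)` with rows `(A(λ), B(λ))` and `(C(λ), A(-λ))`. -/
def T (n : ℕ) (α x : ℂ) : Matrix (Fin 2) (Fin 2) (Coeffs n) :=
  !![at' (polyA n α) x, at' (polyB n) x;
     at' (polyC n) x, at' (polyA n α) (-x)]

/-! ### The brackets `{·,·}_k` -/

/-- The defining relations of `{·,·}_k` on the generating functions `A(λ)`, `B(λ)`, `C(λ)`.
The spectral parameters `λ`, `μ` are called `x`, `y`; they range over all complex numbers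
for which the denominators `λ ± μ` do not vanish. -/
structure SatisfiesFamilyRelations (n : ℕ) (η α : ℂ) (k : ℕ)
    (b : Coeffs n →ₗ[ℂ] Coeffs n →ₗ[ℂ] Coeffs n) : Prop where
  BB : ∀ x y : ℂ, x - y ≠ 0 → x + y ≠ 0 →
    b (at' (polyB n) x) (at' (polyB n) y) = 0
  AA : ∀ x y : ℂ, x - y ≠ 0 → x + y ≠ 0 →
    b (at' (polyA n α) x) (at' (polyA n α) y) =
      (η / (x + y)) •
        (y ^ (2 * k) • (at' (polyB n) x * at' (polyC n) y)
          - x ^ (2 * k) • (at' (polyB n) y * at' (polyC n) x))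
  CC : ∀ x y : ℂ, x - y ≠ 0 → x + y ≠ 0 →
    b (at' (polyC n) x) (at' (polyC n) y) =
      (2 * η) •
        ((at' (polyRho n α k) (-y) * at' (polyA n α) y
            - at' (polyRho n α k) y * at' (polyA n α) (-y)) * at' (polyC n) x)
      - (2 * η) •
        ((at' (polyRho n α k) (-x) * at' (polyA n α) x
            - at' (polyRho n α k) x * at' (polyA n α) (-x)) * at' (polyC n) y)
  AB : ∀ x y : ℂ, x - y ≠ 0 → x + y ≠ 0 →
    b (at' (polyA n α) x) (at' (polyB n) y) =
      (η / (x - y)) •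
        (x ^ (2 * k) • (at' (polyA n α) x * at' (polyB n) y)
          - y ^ (2 * k) • (at' (polyA n α) y * at' (polyB n) x))
      + (η / (x + y)) •
        (x ^ (2 * k) • (at' (polyA n α) x * at' (polyB n) y)
          + y ^ (2 * k) • (at' (polyA n α) (-y) * at' (polyB n) x))
      - (2 * η) • (at' (polyRho n α k) x * at' (polyB n) x * at' (polyB n) y)
  AC : ∀ x y : ℂ, x - y ≠ 0 → x + y ≠ 0 →
    b (at' (polyA n α) x) (at' (polyC n) y) =
      -((η / (x - y)) •
        (y ^ (2 * k) • (at' (polyA n α) x * at' (polyC n) y)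
          - x ^ (2 * k) • (at' (polyA n α) y * at' (polyC n) x)))
      - (2 * η * (k : ℂ) * x) • (at' (polyA n α) x * at' (polyC n) y)
      - (η / (x + y)) •
        (y ^ (2 * k) • (at' (polyA n α) x * at' (polyC n) y)
          + x ^ (2 * k) • (at' (polyA n α) (-y) * at' (polyC n) x))
      + (2 * η) • (at' (polyRho n α k) x * at' (polyB n) x * at' (polyC n) y)
  BC : ∀ x y : ℂ, x - y ≠ 0 → x + y ≠ 0 →
    b (at' (polyB n) x) (at' (polyC n) y) =
      (η * x ^ (2 * k) / (x - y)) •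
        (at' (polyA n α) (-x) * at' (polyA n α) y
          - at' (polyA n α) x * at' (polyA n α) (-y))
      + (η * x ^ (2 * k) / (x + y)) •
        (at' (polyA n α) x * at' (polyA n α) y
          - at' (polyA n α) (-x) * at' (polyA n α) (-y))
      + (2 * η) •
        ((at' (polyRho n α k) y * at' (polyA n α) (-y)
            - at' (polyRho n α k) (-y) * at' (polyA n α) y) * at' (polyB n) x)

/-! ### The rational reflection equation algebra -/

/-- The permutation matrix `Π` of the tensor square of the two-dimensional space. -/
def permMatrix (n : ℕ) : Matrix (Fin 2 × Fin 2) (Fin 2 × Fin 2) (Coeffs n) :=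
  Matrix.of fun p q => if p.1 = q.2 ∧ p.2 = q.1 then 1 else 0

/-- The rational `r`-matrix `r(λ) = (-η / λ) Π`. -/
def rMatrix (n : ℕ) (η x : ℂ) : Matrix (Fin 2 × Fin 2) (Fin 2 × Fin 2) (Coeffs n) :=
  (-η / x) • permMatrix n

/-- `T₁(λ) = T(λ) ⊗ I`. -/
def T₁ (n : ℕ) (α x : ℂ) : Matrix (Fin 2 × Fin 2) (Fin 2 × Fin 2) (Coeffs n) :=
  T n α x ⊗ₖ (1 : Matrix (Fin 2) (Fin 2) (Coeffs n))

/-- `T₂(μ) = I ⊗ T(μ)`. -/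
def T₂ (n : ℕ) (α y : ℂ) : Matrix (Fin 2 × Fin 2) (Fin 2 × Fin 2) (Coeffs n) :=
  (1 : Matrix (Fin 2) (Fin 2) (Coeffs n)) ⊗ₖ T n α y

/-- The `4 × 4` matrix `{T₁(λ), T₂(μ)}` of the brackets `{T_{ij}(λ), T_{kl}(μ)}`
(row index `(i, k)`, column index `(j, l)`). -/
def bracketMatrix (n : ℕ) (α : ℂ) (b : Coeffs n →ₗ[ℂ] Coeffs n →ₗ[ℂ] Coeffs n) (x y : ℂ) :
    Matrix (Fin 2 × Fin 2) (Fin 2 × Fin 2) (Coeffs n) :=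
  Matrix.of fun p q => b (T n α x p.1 q.1) (T n α y p.2 q.2)

/-- The relation
`{T₁(λ), T₂(μ)} = [r(λ-μ), T₁(λ) T₂(μ)] + T₁(λ) r(λ+μ) T₂(μ) - T₂(μ) r(λ+μ) T₁(λ)`
with `r(λ) = (-η / λ) Π`. -/
def SatisfiesReflectionEquation (n : ℕ) (η α : ℂ)
    (b : Coeffs n →ₗ[ℂ] Coeffs n →ₗ[ℂ] Coeffs n) : Prop :=
  ∀ x y : ℂ, x - y ≠ 0 → x + y ≠ 0 →
    bracketMatrix n α b x y =
      (rMatrix n η (x - y) * (T₁ n α x * T₂ n α y)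
        - (T₁ n α x * T₂ n α y) * rMatrix n η (x - y))
      + T₁ n α x * rMatrix n η (x + y) * T₂ n α y
      - T₂ n α y * rMatrix n η (x + y) * T₁ n α x

end ReflectionAlgebra

end

noncomputable section

open Polynomial
open scoped Kronecker

/-! Put `u = λ²` and write `A(λ) = E(u) + λ O(u)`, `B(λ) = λ B(u)`, `C(λ) = λ C(u)`. In these terms
the relations of `{·,·}_k` say that the brackets of the coefficients of `E`, `O`, `B`, `C` are
generated by constant multiples of `1` or `u` times the polynomials
`f(u) (p(u) q(v) - p(v) q(u)) / (u - v)` reduced modulo the monic polynomial `B(u)`, where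
`f = η u^k`, and by one further term for `{C, C}`. These expressions make sense for every linear
polynomial `f` and depend linearly on it, so the compatibility of the two brackets is the Jacobi
identity for all linear `f`.

The values of a generating function at infinitely many points span the coordinates among its
coefficients. Therefore the Jacobi identity and the uniqueness of a bracket need only be verified on
generating functions at generic points, where they are identities between rational functions of the
parameters. For `k = 0` the relations are the entries of the reflection equation: since the
permutation matrix interchanges the tensor factors, it can be moved to the left of every product. -/

/-! ### Skew biderivations and their Jacobiators -/

section Biderivation

variable {R : Type*} [CommRing R] [Algebra ℂ R] {b : R →ₗ[ℂ] R →ₗ[ℂ] R}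

/-- The Jacobiator of a bracket, whose vanishing is the Jacobi identity. -/
def jacobiator (b : R →ₗ[ℂ] R →ₗ[ℂ] R) (f g h : R) : R :=
  b f (b g h) + b g (b h f) + b h (b f g)

theorem jacobiator_rotate (f g h : R) : jacobiator b f g h = jacobiator b g h f := by
  unfold jacobiator
  abel

namespace IsSkewBiderivation

theorem map_algebraMap (hb : IsSkewBiderivation b) (f : R) (c : ℂ) :
    b f (algebraMap ℂ R c) = 0 := by
  have map_one : b f 1 = 0 := by simpa using hb.leibniz f 1 1
  rw [Algebra.algebraMap_eq_smul_one, map_smul, map_one, smul_zero]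

theorem algebraMap_left (hb : IsSkewBiderivation b) (c : ℂ) (f : R) :
    b (algebraMap ℂ R c) f = 0 := by
  rw [hb.skew, hb.map_algebraMap, neg_zero]

/-- The derivation obtained from a skew biderivation by fixing its first argument. -/
def derivation (hb : IsSkewBiderivation b) (f : R) : Derivation ℂ R R :=
  Derivation.mk' (b f) fun g h => by
    rw [hb.leibniz, smul_eq_mul, smul_eq_mul, mul_comm (b f g), add_comm]

theorem jacobiator_swap (hb : IsSkewBiderivation b) (f g h : R) :
    jacobiator b f g h = -jacobiator b g f h := by
  unfold jacobiator
  rw [hb.skew f h, hb.skew h g, hb.skew g f]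
  simp only [map_neg]
  abel

/-- The Jacobiator of a skew biderivation as a derivation in its last argument. -/
def jacobiatorDerivation (hb : IsSkewBiderivation b) (f g : R) : Derivation ℂ R R :=
  Derivation.mk' (b f ∘ₗ b g + b g ∘ₗ b.flip f + b.flip (b f g)) fun h k => by
    simp only [LinearMap.add_apply, LinearMap.comp_apply, LinearMap.flip_apply, smul_eq_mul]
    rw [hb.skew (h * k) f, hb.skew (h * k) (b f g), hb.skew h f, hb.skew k f,
      hb.skew h (b f g), hb.skew k (b f g)]
    simp only [hb.leibniz, map_neg, map_add]
    ring

theorem jacobiator_eq_zero_of_sorted {ι κ α : Type*} [LinearOrder α] {F : ι → κ → R}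
    (hb : IsSkewBiderivation b) (r : ι → α)
    (h : ∀ {i j k}, r i ≤ r j → r j ≤ r k → ∀ {u v w : κ}, u ≠ v → u ≠ w → v ≠ w →
      jacobiator b (F i u) (F j v) (F k w) = 0)
    (i j k : ι) {u v w : κ} (huv : u ≠ v) (huw : u ≠ w) (hvw : v ≠ w) :
    jacobiator b (F i u) (F j v) (F k w) = 0 := by
  have of_le {i j k : ι} {u v w : κ} (hij : r i ≤ r j) (hik : r i ≤ r k) (huv : u ≠ v) (huw : u ≠ w)
      (hvw : v ≠ w) : jacobiator b (F i u) (F j v) (F k w) = 0 := by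
    rcases le_total (r j) (r k) with hjk | hkj
    · exact h hij hjk huv huw hvw
    · rw [jacobiator_rotate, hb.jacobiator_swap, jacobiator_rotate, jacobiator_rotate,
        h hik hkj huw huv hvw.symm, neg_zero]
  by_cases hi : r i ≤ r j ∧ r i ≤ r k
  · exact of_le hi.1 hi.2 huv huw hvw
  by_cases hj : r j ≤ r k ∧ r j ≤ r i
  · rw [jacobiator_rotate]
    exact of_le hj.1 hj.2 hvw huv.symm huw.symm
  · rw [jacobiator_rotate, jacobiator_rotate]
    exact of_le (by grind) (by grind) huw.symm hvw.symm huv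

end IsSkewBiderivation

end Biderivation

section PolynomialAlgebra

variable {σ : Type*} {b b' : MvPolynomial σ ℂ →ₗ[ℂ] MvPolynomial σ ℂ →ₗ[ℂ] MvPolynomial σ ℂ}

theorem IsSkewBiderivation.ext_X (hb : IsSkewBiderivation b) (hb' : IsSkewBiderivation b')
    (h : ∀ s t, b (.X s) (.X t) = b' (.X s) (.X t)) : b = b' := by
  have X_left (s : σ) : hb.derivation (.X s) = hb'.derivation (.X s) :=
    MvPolynomial.derivation_ext (h s)
  have eq_derivation (f : MvPolynomial σ ℂ) : hb.derivation f = hb'.derivation f :=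
    MvPolynomial.derivation_ext fun s =>
      calc b f (.X s) = -b (.X s) f := hb.skew _ _
        _ = -b' (.X s) f := congrArg Neg.neg (DFunLike.congr_fun (X_left s) f)
        _ = b' f (.X s) := (hb'.skew _ _).symm
  exact LinearMap.ext₂ fun f g => DFunLike.congr_fun (eq_derivation f) g

theorem IsSkewBiderivation.isPoissonBracket_of_jacobiator_X (hb : IsSkewBiderivation b)
    (h : ∀ r s t, jacobiator b (.X r) (.X s) (.X t) = 0) : IsPoissonBracket b := by
  have ext_last {f g : MvPolynomial σ ℂ} (hfg : ∀ t, jacobiator b f g (.X t) = 0)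
      (p : MvPolynomial σ ℂ) : jacobiator b f g p = 0 :=
    DFunLike.congr_fun (MvPolynomial.derivation_ext (D₁ := hb.jacobiatorDerivation f g)
      (D₂ := 0) hfg) p
  have XX (r s) : ∀ p, jacobiator b (.X r) (.X s) p = 0 := ext_last (h r s)
  have X_left (r p) : ∀ q, jacobiator b (.X r) p q = 0 := ext_last fun s => by
    rw [jacobiator_rotate, jacobiator_rotate, hb.jacobiator_swap, XX, neg_zero]
  exact ⟨hb, fun f g => ext_last fun t => by
    rw [jacobiator_rotate, jacobiator_rotate, X_left]⟩

section Fintype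

variable [Fintype σ]

/-- The biderivation `∑ π s t ∂ₛ ⊗ ∂ₜ` of a polynomial algebra, with value `π s t` on the pair
of variables `s`, `t`. -/
def biderivation (π : σ → σ → MvPolynomial σ ℂ) :
    MvPolynomial σ ℂ →ₗ[ℂ] MvPolynomial σ ℂ →ₗ[ℂ] MvPolynomial σ ℂ :=
  ∑ s, ∑ t, (LinearMap.mul ℂ _).compl₁₂ (π s t • (MvPolynomial.pderiv s).toLinearMap)
    (MvPolynomial.pderiv t).toLinearMap

theorem biderivation_apply (π : σ → σ → MvPolynomial σ ℂ) (f g : MvPolynomial σ ℂ) :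
    biderivation π f g =
      ∑ s, ∑ t, π s t * MvPolynomial.pderiv s f * MvPolynomial.pderiv t g := by
  simp [biderivation]

theorem biderivation_X_X (π : σ → σ → MvPolynomial σ ℂ) (s t : σ) :
    biderivation π (.X s) (.X t) = π s t := by
  classical
  simp [biderivation_apply, MvPolynomial.pderiv_X, Pi.single_apply]

theorem isSkewBiderivation_biderivation {π : σ → σ → MvPolynomial σ ℂ}
    (hπ : ∀ s t, π s t = -π t s) : IsSkewBiderivation (biderivation π) where
  skew f g := by
    rw [biderivation_apply, biderivation_apply, Finset.sum_comm]
    simp only [← Finset.sum_neg_distrib]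
    refine Finset.sum_congr rfl fun s _ => Finset.sum_congr rfl fun t _ => ?_
    rw [hπ t s]
    ring
  leibniz f g h := by
    simp only [biderivation_apply, Derivation.leibniz, smul_eq_mul, Finset.sum_mul,
      Finset.mul_sum, ← Finset.sum_add_distrib]
    refine Finset.sum_congr rfl fun s _ => Finset.sum_congr rfl fun t _ => ?_
    ring

theorem biderivation_smul_add_smul (c c' : ℂ) (π π' : σ → σ → MvPolynomial σ ℂ) :
    c • biderivation π + c' • biderivation π' = biderivation (c • π + c' • π') := by
  refine LinearMap.ext₂ fun f g => ?_
  simp only [LinearMap.add_apply, LinearMap.smul_apply, biderivation_apply, Finset.smul_sum,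
    ← Finset.sum_add_distrib, Pi.add_apply, Pi.smul_apply, add_mul, smul_mul_assoc]

end Fintype

end PolynomialAlgebra

/-! ### Linear maps on generating polynomials -/

section GeneratingPolynomial

open Filter

variable {K R S : Type*} [CommRing K] [CommRing R] [CommRing S] [Algebra K R] [Algebra K S]

theorem map_eval_eq_eval_of_map_coeff (L : R →ₗ[K] S) {p : R[X]} {q : S[X]}
    (h : ∀ i, L (p.coeff i) = q.coeff i) (x : K) :
    L (p.eval (algebraMap K R x)) = q.eval (algebraMap K S x) := by
  have hp : p.natDegree < max p.natDegree q.natDegree + 1 := by lia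
  have hq : q.natDegree < max p.natDegree q.natDegree + 1 := by lia
  rw [eval_eq_sum_range' hp, eval_eq_sum_range' hq, map_sum]
  refine Finset.sum_congr rfl fun i _ => ?_
  rw [← map_pow, ← map_pow, ← Algebra.commutes, ← Algebra.smul_def, ← Algebra.commutes,
    ← Algebra.smul_def, map_smul, h]

theorem map_coeff_eq_zero_of_frequently [IsDomain S] [FaithfulSMul K S] (L : R →ₗ[K] S) {p : R[X]}
    (h : ∃ᶠ x in cofinite, L (p.eval (algebraMap K R x)) = 0) (i : ℕ) : L (p.coeff i) = 0 := by
  let q : S[X] := ∑ i ∈ p.support, monomial i (L (p.coeff i))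
  have hq (i) : L (p.coeff i) = q.coeff i := by
    simp +contextual [q, coeff_monomial]
  have infinite_roots : {y | q.IsRoot y}.Infinite := by
    refine ((frequently_cofinite_iff_infinite.1 h).image
      (FaithfulSMul.algebraMap_injective K S).injOn).mono ?_
    rintro _ ⟨x, hx, rfl⟩
    rwa [Set.mem_ofPred_eq, IsRoot, ← map_eval_eq_eval_of_map_coeff L hq]
  rw [hq, eq_zero_of_infinite_isRoot q infinite_roots, coeff_zero]

theorem map_eval_eval_eq_evalEval_of_map_coeff_coeff (b : R →ₗ[K] R →ₗ[K] R) {p q : R[X]}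
    {G : R[X][X]} (h : ∀ i j, b (p.coeff i) (q.coeff j) = (G.coeff i).coeff j) (x y : K) :
    b (p.eval (algebraMap K R x)) (q.eval (algebraMap K R y)) =
      G.evalEval (algebraMap K R y) (algebraMap K R x) := by
  rw [← map_evalRingHom_eval]
  refine map_eval_eq_eval_of_map_coeff (b.flip _) (fun i => ?_) x
  rw [LinearMap.flip_apply, coeff_map, coe_evalRingHom]
  exact map_eval_eq_eval_of_map_coeff (b _) (h i) y

end GeneratingPolynomial

section GeneratingFamily

open Filter

variable {σ ι : Type*} {b b' : MvPolynomial σ ℂ →ₗ[ℂ] MvPolynomial σ ℂ →ₗ[ℂ] MvPolynomial σ ℂ}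
  {P : ι → (MvPolynomial σ ℂ)[X]}

theorem IsSkewBiderivation.ext_of_eventually (hb : IsSkewBiderivation b)
    (hb' : IsSkewBiderivation b') (hP : ∀ s, ∃ i m, (P i).coeff m = .X s)
    (h : ∀ i j x, ∀ᶠ y in cofinite,
      b ((P i).eval (algebraMap ℂ _ x)) ((P j).eval (algebraMap ℂ _ y)) =
        b' ((P i).eval (algebraMap ℂ _ x)) ((P j).eval (algebraMap ℂ _ y))) :
    b = b' := by
  refine hb.ext_X hb' fun s t => ?_
  obtain ⟨i, l, hs⟩ := hP s
  obtain ⟨j, m, ht⟩ := hP t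
  rw [← hs, ← ht]
  have eval_coeff (x : ℂ) :
      (b - b') ((P i).eval (algebraMap ℂ _ x)) ((P j).coeff m) = 0 :=
    map_coeff_eq_zero_of_frequently _ ((h i j x).mono fun _ => sub_eq_zero.2).frequently m
  exact sub_eq_zero.1 <| map_coeff_eq_zero_of_frequently ((b - b').flip _)
    (Frequently.of_forall eval_coeff) l

theorem IsSkewBiderivation.isPoissonBracket_of_jacobiator_eval (hb : IsSkewBiderivation b)
    (hP : ∀ s, ∃ i m, (P i).coeff m = .X s)
    (h : ∀ i j k, ∀ {u v w : ℂ}, u ≠ v → u ≠ w → v ≠ w →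
      jacobiator b ((P i).eval (algebraMap ℂ _ u)) ((P j).eval (algebraMap ℂ _ v))
        ((P k).eval (algebraMap ℂ _ w)) = 0) :
    IsPoissonBracket b := by
  have X_right {f g : MvPolynomial σ ℂ} (t : σ)
      (hfg : ∀ k, ∀ᶠ w in cofinite, jacobiator b f g ((P k).eval (algebraMap ℂ _ w)) = 0) :
      jacobiator b f g (.X t) = 0 := by
    obtain ⟨k, m, ht⟩ := hP t
    rw [← ht]
    exact map_coeff_eq_zero_of_frequently (hb.jacobiatorDerivation f g).toLinearMap
      (hfg k).frequently m
  have eval_eval_X (i j t) {u v : ℂ} (huv : u ≠ v) :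
      jacobiator b ((P i).eval (algebraMap ℂ _ u)) ((P j).eval (algebraMap ℂ _ v)) (.X t) = 0 :=
    X_right t fun k => by
      filter_upwards [eventually_cofinite_ne u, eventually_cofinite_ne v] with w hu hv
      exact h i j k huv hu.symm hv.symm
  have X_eval_X (s i t u) :
      jacobiator b (.X s) ((P i).eval (algebraMap ℂ _ u)) (.X t) = 0 :=
    X_right t fun j => by
      filter_upwards [eventually_cofinite_ne u] with v hv
      rw [jacobiator_rotate]
      exact eval_eval_X i j s hv.symm
  refine hb.isPoissonBracket_of_jacobiator_X fun r s t =>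
    X_right t fun i => Eventually.of_forall fun u => ?_
  rw [jacobiator_rotate]
  exact X_eval_X s i r u

end GeneratingFamily

/-! ### Bezoutians -/

section Bezoutian

variable {R : Type*} [CommRing R] {n : ℕ} {f p q B : R[X]}

/-- The Bezoutian `(p(u) q(v) - p(v) q(u)) / (u - v)` of two polynomials. Here and below the outer
variable of `R[X][X]` is `u` and the inner one is `v`. -/
def bezoutian (p q : R[X]) : R[X][X] :=
  (p.map C * C q - C p * q.map C) /ₘ (X - C X)

theorem X_sub_C_mul_bezoutian (p q : R[X]) :
    (X - C X) * bezoutian p q = p.map C * C q - C p * q.map C :=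
  mul_divByMonic_eq_iff_isRoot.2 <| by simp [IsRoot, eval_map, mul_comm]

theorem sub_mul_evalEval_bezoutian (p q : R[X]) (u v : R) :
    (u - v) * (bezoutian p q).evalEval v u = p.eval u * q.eval v - p.eval v * q.eval u := by
  have h := congrArg (evalEval v u) (X_sub_C_mul_bezoutian p q)
  simpa only [evalEval_mul, evalEval_sub, evalEval_X, evalEval_C, eval_X, evalEval_map_C] using h

theorem coeff_bezoutian_sub_X_mul (p q : R[X]) (i : ℕ) :
    (bezoutian p q).coeff i - X * (bezoutian p q).coeff (i + 1) =
      C (p.coeff (i + 1)) * q - C (q.coeff (i + 1)) * p := by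
  have h := congrArg (coeff · (i + 1)) (X_sub_C_mul_bezoutian p q)
  simp only [sub_mul, coeff_sub, coeff_X_mul, coeff_C_mul, coeff_mul_C, coeff_map] at h
  linear_combination h

theorem X_mul_coeff_zero_bezoutian (p q : R[X]) :
    X * (bezoutian p q).coeff 0 = C (q.coeff 0) * p - C (p.coeff 0) * q := by
  have h := congrArg (coeff · 0) (X_sub_C_mul_bezoutian p q)
  simp only [sub_mul, coeff_sub, coeff_X_mul_zero, coeff_C_mul, coeff_mul_C, coeff_map] at h
  linear_combination -h

theorem coeff_bezoutian_of_le (hp : p.natDegree ≤ n) (hq : q.natDegree ≤ n) {i : ℕ}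
    (hi : n ≤ i) : (bezoutian p q).coeff i = 0 := by
  rcases eq_or_ne (bezoutian p q) 0 with h0 | h0
  · rw [h0, coeff_zero]
  have : Nontrivial R[X] := nontrivial_of_ne _ _ (leadingCoeff_ne_zero.2 h0)
  refine coeff_eq_zero_of_natDegree_lt (lt_of_lt_of_le ?_ hi)
  calc (bezoutian p q).natDegree
      < (X - C X : R[X][X]).natDegree + (bezoutian p q).natDegree := by simp
    _ = (p.map C * C q - C p * q.map C).natDegree := by
      rw [← (monic_X_sub_C X).natDegree_mul' h0, X_sub_C_mul_bezoutian]
    _ ≤ n := (natDegree_sub_le _ _).trans <| max_le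
      ((natDegree_mul_C_le _ _).trans (natDegree_map_le.trans hp))
      ((natDegree_C_mul_le _ _).trans (natDegree_map_le.trans hq))

theorem coeff_coeff_bezoutian_of_le (hp : p.natDegree ≤ n) (hq : q.natDegree ≤ n) (i : ℕ) {j : ℕ}
    (hj : n ≤ j) : ((bezoutian p q).coeff i).coeff j = 0 := by
  have hpj {j} (hj : n ≤ j) : p.coeff (j + 1) = 0 := coeff_eq_zero_of_natDegree_lt (by lia)
  have hqj {j} (hj : n ≤ j) : q.coeff (j + 1) = 0 := coeff_eq_zero_of_natDegree_lt (by lia)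
  induction i generalizing j with
  | zero =>
    rw [← coeff_X_mul, X_mul_coeff_zero_bezoutian]
    simp [hpj hj, hqj hj]
  | succ i ih =>
    have h := congrArg (coeff · (j + 1)) (coeff_bezoutian_sub_X_mul p q i)
    simpa [hpj hj, hqj hj, ih (hj.trans j.le_succ)] using h

/-- The combination of two polynomials of degree at most `n` in which the terms of degree `n`
cancel; it is the leading coefficient in `u` of their Bezoutian. -/
def leadingCross (n : ℕ) (p q : R[X]) : R[X] :=
  C (p.coeff n) * q - C (q.coeff n) * p

theorem coeff_leadingCross_of_le (hp : p.natDegree ≤ n) (hq : q.natDegree ≤ n) {i : ℕ}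
    (hi : n ≤ i) : (leadingCross n p q).coeff i = 0 := by
  rcases hi.eq_or_lt with rfl | hi
  · simp [leadingCross, mul_comm]
  · simp [leadingCross, coeff_eq_zero_of_natDegree_lt (hp.trans_lt hi),
      coeff_eq_zero_of_natDegree_lt (hq.trans_lt hi)]

theorem coeff_X_mul_bezoutian (hp : p.natDegree ≤ n) (hq : q.natDegree ≤ n) :
    (X * bezoutian p q).coeff n = leadingCross n p q := by
  have h := congrArg (coeff · n) (X_sub_C_mul_bezoutian p q)
  simp only [sub_mul, coeff_sub, coeff_C_mul, coeff_mul_C, coeff_map,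
    coeff_bezoutian_of_le hp hq le_rfl] at h
  rw [leadingCross]
  linear_combination h

theorem coeff_X_mul_X_mul_bezoutian (hp : p.natDegree ≤ n) (hq : q.natDegree ≤ n) :
    (X * (X * bezoutian p q)).coeff n =
      X * leadingCross n p q + (C ((X * p).coeff n) * q - C ((X * q).coeff n) * p) := by
  have h : X * (X * bezoutian p q) =
      C X * (X * bezoutian p q) + ((X * p).map C * C q - C p * (X * q).map C) := by
    simp only [Polynomial.map_mul, map_X]
    linear_combination X * X_sub_C_mul_bezoutian p q
  rw [h, coeff_add, coeff_C_mul, coeff_X_mul_bezoutian hp hq, coeff_sub, coeff_mul_C, coeff_C_mul,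
    coeff_map, coeff_map, mul_comm p]

/-- The remainder of `f(u) (p(u) q(v) - p(v) q(u)) / (u - v)` modulo `B(u)`. -/
def reducedBezoutian (f B p q : R[X]) : R[X][X] :=
  (f.map C * bezoutian p q) %ₘ B.map C

theorem reducedBezoutian_add (f g B p q : R[X]) :
    reducedBezoutian (f + g) B p q = reducedBezoutian f B p q + reducedBezoutian g B p q := by
  rw [reducedBezoutian, Polynomial.map_add, add_mul, add_modByMonic]
  rfl

theorem reducedBezoutian_C_mul (c : R) (f B p q : R[X]) :
    reducedBezoutian (C c * f) B p q = C (C c) * reducedBezoutian f B p q := by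
  rw [reducedBezoutian, Polynomial.map_mul, map_C, mul_assoc, ← smul_eq_C_mul, smul_modByMonic,
    smul_eq_C_mul]
  rfl

theorem coeff_map_C_mul_bezoutian (hf : f.natDegree ≤ 1) (i : ℕ) :
    (f.map C * bezoutian p q).coeff i = C (f.coeff 1) * (X * bezoutian p q).coeff i +
      C (f.coeff 0) * (bezoutian p q).coeff i := by
  obtain ⟨c, d, rfl⟩ := exists_eq_X_add_C_of_natDegree_le_one hf
  simp [add_mul, mul_assoc]

theorem reducedBezoutian_eq (hB : B.Monic) (hf : f.natDegree ≤ 1) (hp : p.natDegree ≤ B.natDegree)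
    (hq : q.natDegree ≤ B.natDegree) :
    reducedBezoutian f B p q = f.map C * bezoutian p q -
      C (C (f.coeff 1) * leadingCross B.natDegree p q) * B.map C := by
  nontriviality R
  refine (div_modByMonic_unique (C (C (f.coeff 1) * leadingCross B.natDegree p q)) _ (hB.map C)
    ⟨by ring, ?_⟩).2
  rw [degree_map_eq_of_injective C_injective, degree_eq_natDegree hB.ne_zero,
    degree_lt_iff_coeff_zero]
  intro i hi
  rw [coeff_sub, coeff_map_C_mul_bezoutian hf, coeff_bezoutian_of_le hp hq hi, coeff_C_mul,
    coeff_map]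
  rcases hi.eq_or_lt with rfl | hi
  · simp [coeff_X_mul_bezoutian hp hq, hB.coeff_natDegree]
  · obtain ⟨i, rfl⟩ := Nat.exists_eq_add_of_lt hi
    rw [coeff_eq_zero_of_natDegree_lt hi, coeff_X_mul, coeff_bezoutian_of_le hp hq (by lia)]
    simp

theorem coeff_reducedBezoutian_of_le (hB : B.Monic) (f p q : R[X]) {i : ℕ}
    (hi : B.natDegree ≤ i) : (reducedBezoutian f B p q).coeff i = 0 := by
  nontriviality R
  refine coeff_eq_zero_of_degree_lt ((degree_modByMonic_lt _ (hB.map C)).trans_le ?_)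
  rw [degree_map_eq_of_injective C_injective]
  exact degree_le_natDegree.trans (mod_cast hi)

theorem coeff_coeff_reducedBezoutian_of_le (hB : B.Monic) (hf : f.natDegree ≤ 1)
    (hp : p.natDegree ≤ B.natDegree) (hq : q.natDegree ≤ B.natDegree) (i : ℕ) {j : ℕ}
    (hj : B.natDegree ≤ j) : ((reducedBezoutian f B p q).coeff i).coeff j = 0 := by
  have coeff_X_mul_zero : ((X * bezoutian p q).coeff i).coeff j = 0 := by
    cases i with
    | zero => simp
    | succ i => rw [coeff_X_mul, coeff_coeff_bezoutian_of_le hp hq i hj]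
  rw [reducedBezoutian_eq hB hf hp hq, coeff_sub, coeff_map_C_mul_bezoutian hf, coeff_C_mul,
    coeff_map, coeff_sub, coeff_add, coeff_C_mul, coeff_C_mul, coeff_mul_C, coeff_C_mul,
    coeff_X_mul_zero, coeff_coeff_bezoutian_of_le hp hq i hj, coeff_leadingCross_of_le hp hq hj]
  simp

theorem sub_mul_evalEval_reducedBezoutian (hB : B.Monic) (hf : f.natDegree ≤ 1)
    (hp : p.natDegree ≤ B.natDegree) (hq : q.natDegree ≤ B.natDegree) (u v : R) :
    (u - v) * (reducedBezoutian f B p q).evalEval v u =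
      f.eval u * (p.eval u * q.eval v - p.eval v * q.eval u) - (u - v) * (f.coeff 1 *
        (p.coeff B.natDegree * q.eval v - q.coeff B.natDegree * p.eval v) * B.eval u) := by
  simp only [reducedBezoutian_eq hB hf hp hq, leadingCross, evalEval_sub, evalEval_mul,
    evalEval_map_C, evalEval_C, eval_sub, eval_mul, eval_C]
  linear_combination f.eval u * sub_mul_evalEval_bezoutian p q u v

theorem coeff_X_mul_reducedBezoutian (hB : B.Monic) (hf : f.natDegree ≤ 1)
    (hp : p.natDegree ≤ B.natDegree) (hq : q.natDegree ≤ B.natDegree) :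
    (X * reducedBezoutian f B p q).coeff B.natDegree =
      f * leadingCross B.natDegree p q
        + C (f.coeff 1) * (C ((X * p).coeff B.natDegree) * q - C ((X * q).coeff B.natDegree) * p)
        - C (f.coeff 1 * (X * B).coeff B.natDegree) * leadingCross B.natDegree p q := by
  obtain ⟨c, d, rfl⟩ := exists_eq_X_add_C_of_natDegree_le_one hf
  have h : X * reducedBezoutian (C c * X + C d) B p q =
      C (C c) * (X * (X * bezoutian p q)) + C (C d) * (X * bezoutian p q)
        - C (C c * leadingCross B.natDegree p q) * (X * B).map C := by
    rw [reducedBezoutian_eq hB hf hp hq]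
    simp only [Polynomial.map_add, Polynomial.map_mul, map_C, map_X, coeff_add, coeff_mul_X,
      coeff_C_zero, coeff_C_succ, add_zero, map_mul]
    ring
  rw [h, coeff_sub, coeff_add, coeff_C_mul, coeff_C_mul, coeff_C_mul, coeff_map,
    coeff_X_mul_X_mul_bezoutian hp hq, coeff_X_mul_bezoutian hp hq]
  simp only [coeff_add, coeff_mul_X, coeff_C_zero, coeff_C_succ, add_zero, map_mul]
  ring

end Bezoutian

theorem coeff_coeff_swap {R : Type*} [CommRing R] (G : R[X][X]) (i j : ℕ) :
    ((Bivariate.swap G).coeff i).coeff j = (G.coeff j).coeff i := by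
  induction G using Polynomial.induction_on' with
  | add p q hp hq => simp only [map_add, coeff_add, hp, hq]
  | monomial k p =>
    induction p using Polynomial.induction_on' with
    | add p q hp hq => simp only [map_add, coeff_add, hp, hq]
    | monomial m r =>
      rw [Bivariate.swap_monomial_monomial]
      simp only [coeff_monomial]
      split_ifs <;> simp_all [coeff_monomial]

section EvenOdd

variable {R : Type*} [CommRing R]

/-- The polynomial `E` in `p(λ) = E(λ²) + λ O(λ²)`. -/
def evenPart (p : R[X]) : R[X] :=
  contract 2 p

/-- The polynomial `O` in `p(λ) = E(λ²) + λ O(λ²)`. -/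
def oddPart (p : R[X]) : R[X] :=
  contract 2 p.divX

theorem coeff_evenPart (p : R[X]) (i : ℕ) : (evenPart p).coeff i = p.coeff (2 * i) := by
  rw [evenPart, coeff_contract two_ne_zero, mul_comm]

theorem coeff_oddPart (p : R[X]) (i : ℕ) : (oddPart p).coeff i = p.coeff (2 * i + 1) := by
  rw [oddPart, coeff_contract two_ne_zero, coeff_divX, mul_comm]

theorem expand_evenPart_add_X_mul_expand_oddPart (p : R[X]) :
    expand R 2 (evenPart p) + X * expand R 2 (oddPart p) = p := by
  ext m
  rw [coeff_add]
  rcases m.even_or_odd' with ⟨i, rfl | rfl⟩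
  · rw [coeff_expand_mul' two_pos, coeff_evenPart]
    rcases i with - | i
    · simp
    · rw [show 2 * (i + 1) = 2 * i + 1 + 1 by ring, coeff_X_mul, coeff_expand two_pos,
        if_neg (by lia), add_zero]
  · rw [coeff_X_mul, coeff_expand_mul' two_pos, coeff_oddPart, coeff_expand two_pos,
      if_neg (by lia), zero_add]

theorem eval_eq_eval_evenPart_add_mul_eval_oddPart (p : R[X]) (x : R) :
    p.eval x = (evenPart p).eval (x ^ 2) + x * (oddPart p).eval (x ^ 2) := by
  nth_rw 1 [← expand_evenPart_add_X_mul_expand_oddPart p]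
  simp only [eval_add, eval_mul, eval_X, expand_eval]

theorem coeff_sum_fin_C_mul_X_pow {n : ℕ} (c : Fin n → R) (i : ℕ) :
    (∑ j : Fin n, C (c j) * X ^ (j : ℕ)).coeff i = if hi : i < n then c ⟨i, hi⟩ else 0 := by
  simp only [finsetSum_coeff, coeff_C_mul_X_pow]
  split_ifs with hi
  · rw [Finset.sum_eq_single ⟨i, hi⟩ (fun j _ hj => if_neg fun h => hj (Fin.ext h.symm))
      (fun h => absurd (Finset.mem_univ _) h), if_pos rfl]
  · exact Finset.sum_eq_zero fun j _ => if_neg (by lia)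

end EvenOdd

namespace ReflectionAlgebra

/-! ### The pencil of brackets -/

/-- Names of the four generating functions in the variable `u = λ²`: the even part `E` and the odd
part `O` of `A(λ) = E(λ²) + λ O(λ²)`, and the odd parts of `B(λ) = λ B(λ²)`, `C(λ) = λ C(λ²)`. -/
inductive Kind : Type
  | E
  | O
  | B
  | C

section Pencil

variable {R : Type*} [CommRing R] [Algebra ℂ R]

/-- The algebraic properties of the four generating functions used by the brackets: none has larger
degree than the monic `B`, and the coefficient of `O` in that degree is the number `α`, that of `C`
is zero. -/
structure IsNormalized (α : ℂ) (F : Kind → R[X]) : Prop where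
  monic_B : (F .B).Monic
  natDegree_le (K : Kind) : (F K).natDegree ≤ (F .B).natDegree
  coeff_O : (F .O).coeff (F .B).natDegree = algebraMap ℂ R α
  coeff_C : (F .C).coeff (F .B).natDegree = 0

/-- The generating polynomial in `u`, `v` of the brackets between the coefficients of `F K` and of
`F L`, for `K` before `L` in the list `E`, `O`, `B`, `C`. For `K = L = .C` it still has to be
antisymmetrised in `u` and `v`. -/
def upperBracket (f : ℂ[X]) (F : Kind → R[X]) : Kind → Kind → R[X][X]
  | .E, .O => -(X * reduced .C .B)
  | .E, .B => C 2 * (X * reduced .O .B)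
  | .E, .C => -(C 2 * (X * reduced .O .C))
  | .O, .B => C 2 * reduced .E .B
  | .O, .C => -(C 2 * reduced .E .C)
  | .B, .C => C 4 * reduced .E .O
  | .C, .C => (C (4 * algebraMap ℂ R (f.coeff 1)) *
      leadingCross (F .B).natDegree (F .O) (F .E)).map C * C (F .C)
  | _, _ => 0
where
  reduced (K L : Kind) : R[X][X] := reducedBezoutian (f.map (algebraMap ℂ R)) (F .B) (F K) (F L)

/-- The generating polynomial in `u`, `v` of the brackets between the coefficients of `F K` and of
`F L`. -/
def generatingBracket (f : ℂ[X]) (F : Kind → R[X]) (K L : Kind) : R[X][X] :=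
  upperBracket f F K L - Bivariate.swap (upperBracket f F L K)

/-- The bracket `b` is the one which the linear polynomial `f` attaches to the generating functions
`F`. -/
def IsPencilBracket (f : ℂ[X]) (F : Kind → R[X]) (b : R →ₗ[ℂ] R →ₗ[ℂ] R) : Prop :=
  ∀ K L i j, b ((F K).coeff i) ((F L).coeff j) = ((generatingBracket f F K L).coeff i).coeff j

variable {f : ℂ[X]} {F : Kind → R[X]} {b : R →ₗ[ℂ] R →ₗ[ℂ] R} {α : ℂ}

theorem algebraMap_inv_sub_mul {u v : ℂ} (huv : u ≠ v) :
    algebraMap ℂ R (u - v)⁻¹ * (algebraMap ℂ R u - algebraMap ℂ R v) = 1 := by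
  rw [← map_sub, ← map_mul, inv_mul_cancel₀ (sub_ne_zero.2 huv), map_one]

theorem evalEval_generatingBracket (K L : Kind) (u v : R) :
    (generatingBracket f F K L).evalEval v u =
      (upperBracket f F K L).evalEval v u - (upperBracket f F L K).evalEval u v := by
  rw [generatingBracket, evalEval_sub, ← coe_aevalAeval_eq_evalEval, Bivariate.aevalAeval_swap]
  simp only [coe_aevalAeval_eq_evalEval]

namespace IsNormalized

theorem evalEval_reduced (hF : IsNormalized α F) (hf : f.natDegree ≤ 1) (K L : Kind)
    {u v : ℂ} (huv : u ≠ v) :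
    (upperBracket.reduced f F K L).evalEval (algebraMap ℂ R v) (algebraMap ℂ R u) =
      (f.eval u * (u - v)⁻¹) • ((F K).eval (algebraMap ℂ R u) * (F L).eval (algebraMap ℂ R v) -
        (F K).eval (algebraMap ℂ R v) * (F L).eval (algebraMap ℂ R u)) -
      f.coeff 1 • (((leadingCross (F .B).natDegree (F K) (F L)).eval (algebraMap ℂ R v)) *
        (F .B).eval (algebraMap ℂ R u)) := by
  have isUnit_sub : IsUnit (algebraMap ℂ R u - algebraMap ℂ R v) := by
    rw [← map_sub]
    exact (sub_ne_zero.2 huv).isUnit.map _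
  have h := sub_mul_evalEval_reducedBezoutian hF.monic_B
    (natDegree_map_le.trans hf : (f.map (algebraMap ℂ R)).natDegree ≤ 1) (hF.natDegree_le K)
    (hF.natDegree_le L) (algebraMap ℂ R u) (algebraMap ℂ R v)
  rw [eval_map_algebraMap, aeval_algebraMap_apply_eq_algebraMap_eval, coeff_map] at h
  refine isUnit_sub.mul_left_cancel ?_
  rw [upperBracket.reduced, h]
  simp only [Algebra.smul_def, map_mul, leadingCross, eval_sub, eval_mul, eval_C]
  linear_combination -(algebraMap ℂ R (f.eval u) * ((F K).eval (algebraMap ℂ R u) *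
    (F L).eval (algebraMap ℂ R v) - (F K).eval (algebraMap ℂ R v) *
      (F L).eval (algebraMap ℂ R u))) *
    algebraMap_inv_sub_mul (R := R) huv

theorem eval_coeff_X_mul_reduced (hF : IsNormalized α F) (hf : f.natDegree ≤ 1) (K L : Kind)
    (v : ℂ) :
    ((X * upperBracket.reduced f F K L).coeff (F .B).natDegree).eval (algebraMap ℂ R v) =
      f.eval v • (leadingCross (F .B).natDegree (F K) (F L)).eval (algebraMap ℂ R v) +
      f.coeff 1 • ((X * F K).coeff (F .B).natDegree * (F L).eval (algebraMap ℂ R v) -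
        (X * F L).coeff (F .B).natDegree * (F K).eval (algebraMap ℂ R v) -
        (X * F .B).coeff (F .B).natDegree *
          (leadingCross (F .B).natDegree (F K) (F L)).eval (algebraMap ℂ R v)) := by
  rw [upperBracket.reduced, coeff_X_mul_reducedBezoutian hF.monic_B (natDegree_map_le.trans hf)
    (hF.natDegree_le K) (hF.natDegree_le L)]
  simp only [eval_sub, eval_add, eval_mul, eval_C, eval_map_algebraMap,
    aeval_algebraMap_apply_eq_algebraMap_eval, coeff_map, Algebra.smul_def]
  ring

end IsNormalized

namespace IsPencilBracket

theorem apply_eval (H : IsPencilBracket f F b) (K L : Kind) (u v : ℂ) :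
    b ((F K).eval (algebraMap ℂ R u)) ((F L).eval (algebraMap ℂ R v)) =
      (upperBracket f F K L).evalEval (algebraMap ℂ R v) (algebraMap ℂ R u) -
        (upperBracket f F L K).evalEval (algebraMap ℂ R u) (algebraMap ℂ R v) := by
  rw [map_eval_eval_eq_evalEval_of_map_coeff_coeff b (H K L), evalEval_generatingBracket]

theorem apply_eval_coeff (H : IsPencilBracket f F b) (hb : IsSkewBiderivation b) (K L : Kind)
    (n : ℕ) (v : ℂ) :
    b ((F K).eval (algebraMap ℂ R v)) ((F L).coeff n) =
      -((generatingBracket f F L K).coeff n).eval (algebraMap ℂ R v) := by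
  rw [hb.skew, map_eval_eq_eval_of_map_coeff (b _) (H L K n)]

set_option maxHeartbeats 1000000 in
-- The last step checks a rational identity for each of the twenty sorted triples of kinds.
theorem jacobiator_eq_zero_of_sorted (H : IsPencilBracket f F b)
    (hb : IsSkewBiderivation b) (hf : f.natDegree ≤ 1) (hF : IsNormalized α F) {K L M : Kind}
    (hKL : K.ctorIdx ≤ L.ctorIdx) (hLM : L.ctorIdx ≤ M.ctorIdx) {u v w : ℂ} (huv : u ≠ v)
    (huw : u ≠ w) (hvw : v ≠ w) :
    jacobiator b ((F K).eval (algebraMap ℂ R u)) ((F L).eval (algebraMap ℂ R v))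
      ((F M).eval (algebraMap ℂ R w)) = 0 := by
  have inv_swap (x y : ℂ) : (y - x)⁻¹ = -(x - y)⁻¹ := by rw [← inv_neg, neg_sub]
  have inv_mul_uv := algebraMap_inv_sub_mul (R := R) huv
  have inv_mul_uw := algebraMap_inv_sub_mul (R := R) huw
  have inv_mul_vw := algebraMap_inv_sub_mul (R := R) hvw
  have apply_ofNat (g : R) (n : ℕ) [n.AtLeastTwo] : b g (ofNat(n) : R) = 0 := by
    simpa only [map_ofNat] using hb.map_algebraMap g ofNat(n)
  have reduced_eval := hF.evalEval_reduced hf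
  obtain ⟨c₁, c₀, rfl⟩ := exists_eq_X_add_C_of_natDegree_le_one hf
  cases K <;> cases L <;> first | exact absurd hKL (by decide) | skip
  all_goals cases M <;> first | exact absurd hLM (by decide) | skip
  all_goals
    -- Only the inverses of `u - v`, `u - w`, `v - w` survive, as unknowns subject to `inv_mul_*`.
    simp only [jacobiator, H.apply_eval, H.apply_eval_coeff hb, generatingBracket, upperBracket,
      evalEval_neg, evalEval_mul, evalEval_C, evalEval_X, evalEval_map_C, evalEval_zero, coeff_neg,
      coeff_C_mul, hF.eval_coeff_X_mul_reduced hf, coeff_zero, reduced_eval _ _ huv,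
      reduced_eval _ _ huw, reduced_eval _ _ hvw, reduced_eval _ _ huv.symm,
      reduced_eval _ _ huw.symm, reduced_eval _ _ hvw.symm, leadingCross, eval_C, eval_X,
      eval_ofNat, eval_mul, eval_sub, eval_neg, eval_zero, eval_add, hF.monic_B.coeff_natDegree,
      hF.coeff_O, hF.coeff_C, map_sub, sub_zero, zero_sub, zero_mul, mul_zero, map_neg, map_smul,
      map_zero, hb.leibniz, hb.map_algebraMap, apply_ofNat, inv_swap u v, inv_swap u w,
      inv_swap v w, mul_one, add_zero, one_mul, coeff_add, coeff_X_one, coeff_C_succ]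
  all_goals
    simp only [Algebra.smul_def, map_mul, map_add, map_neg]
    grind

theorem jacobiator_eq_zero (H : IsPencilBracket f F b) (hb : IsSkewBiderivation b)
    (hf : f.natDegree ≤ 1) (hF : IsNormalized α F) (K L M : Kind) {u v w : ℂ} (huv : u ≠ v)
    (huw : u ≠ w) (hvw : v ≠ w) :
    jacobiator b ((F K).eval (algebraMap ℂ R u)) ((F L).eval (algebraMap ℂ R v))
      ((F M).eval (algebraMap ℂ R w)) = 0 :=
  hb.jacobiator_eq_zero_of_sorted Kind.ctorIdx
    (F := fun K u => (F K).eval (algebraMap ℂ R u))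
    (H.jacobiator_eq_zero_of_sorted hb hf hF) K L M huv huw hvw

end IsPencilBracket

end Pencil

section Coefficients

variable {R : Type*} [CommRing R] [Algebra ℂ R] {f g : ℂ[X]} {F : Kind → R[X]} {α : ℂ}

theorem coeff_coeff_generatingBracket (K L : Kind) (i j : ℕ) :
    ((generatingBracket f F K L).coeff i).coeff j =
      ((upperBracket f F K L).coeff i).coeff j - ((upperBracket f F L K).coeff j).coeff i := by
  rw [generatingBracket, coeff_sub, coeff_sub, coeff_coeff_swap]

theorem coeff_coeff_generatingBracket_swap (K L : Kind) (i j : ℕ) :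
    ((generatingBracket f F K L).coeff i).coeff j =
      -((generatingBracket f F L K).coeff j).coeff i := by
  rw [coeff_coeff_generatingBracket, coeff_coeff_generatingBracket, neg_sub]

theorem upperBracket_C_mul_add_C_mul (c d : ℂ) (K L : Kind) :
    upperBracket (C c * f + C d * g) F K L =
      C (C (algebraMap ℂ R c)) * upperBracket f F K L +
        C (C (algebraMap ℂ R d)) * upperBracket g F K L := by
  have reduced_add (K L : Kind) : upperBracket.reduced (C c * f + C d * g) F K L =
      C (C (algebraMap ℂ R c)) * upperBracket.reduced f F K L +
        C (C (algebraMap ℂ R d)) * upperBracket.reduced g F K L := by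
    simp only [upperBracket.reduced, Polynomial.map_add, Polynomial.map_mul, map_C,
      reducedBezoutian_add, reducedBezoutian_C_mul]
  cases K <;> cases L <;>
    simp only [upperBracket, reduced_add, coeff_add, coeff_C_mul, map_add, map_mul,
      Polynomial.map_add, Polynomial.map_mul, map_C] <;>
    ring

theorem coeff_coeff_generatingBracket_C_mul_add_C_mul (c d : ℂ) (K L : Kind) (i j : ℕ) :
    ((generatingBracket (C c * f + C d * g) F K L).coeff i).coeff j =
      c • ((generatingBracket f F K L).coeff i).coeff j +
        d • ((generatingBracket g F K L).coeff i).coeff j := by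
  simp only [coeff_coeff_generatingBracket, upperBracket_C_mul_add_C_mul, coeff_add, coeff_C_mul,
    Algebra.smul_def]
  ring

/-- The number of coordinates among the coefficients of a generating function. -/
def Kind.size (n : ℕ) : Kind → ℕ
  | .E => n + 1
  | _ => n

theorem IsNormalized.coeff_coeff_upperBracket_of_size_le (hF : IsNormalized α F)
    (hf : f.natDegree ≤ 1) {K L : Kind} {i j : ℕ}
    (hij : K.size (F .B).natDegree ≤ i ∨ L.size (F .B).natDegree ≤ j) :
    ((upperBracket f F K L).coeff i).coeff j = 0 := by
  have coeff_reduced (K L : Kind) {i j} (hij : (F .B).natDegree ≤ i ∨ (F .B).natDegree ≤ j) :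
      ((upperBracket.reduced f F K L).coeff i).coeff j = 0 := by
    rcases hij with hi | hj
    · rw [upperBracket.reduced, coeff_reducedBezoutian_of_le hF.monic_B _ _ _ hi, coeff_zero]
    · exact coeff_coeff_reducedBezoutian_of_le hF.monic_B (natDegree_map_le.trans hf)
        (hF.natDegree_le K) (hF.natDegree_le L) i hj
  have coeff_X_mul_reduced (K L : Kind) {i j}
      (hij : (F .B).natDegree + 1 ≤ i ∨ (F .B).natDegree ≤ j) :
      ((X * upperBracket.reduced f F K L).coeff i).coeff j = 0 := by
    cases i with
    | zero => rw [coeff_X_mul_zero, coeff_zero]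
    | succ i => rw [coeff_X_mul, coeff_reduced K L (by lia)]
  have coeff_O_E {i} (hi : (F .B).natDegree ≤ i) :=
    coeff_leadingCross_of_le (hF.natDegree_le .O) (hF.natDegree_le .E) hi
  have coeff_F_C {j} (hj : (F .B).natDegree ≤ j) : (F .C).coeff j = 0 := by
    rcases hj.eq_or_lt with rfl | hj
    · exact hF.coeff_C
    · exact coeff_eq_zero_of_natDegree_lt ((hF.natDegree_le .C).trans_lt hj)
  cases K <;> cases L <;>
    simp only [upperBracket, coeff_zero, coeff_neg, coeff_C_mul, coeff_ofNat_mul, coeff_map,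
      coeff_mul_C]
  case C.C =>
    rcases hij with hi | hj
    · rw [coeff_O_E hi, mul_zero, zero_mul]
    · rw [coeff_F_C hj, mul_zero]
  all_goals
    first | rw [coeff_reduced _ _ hij] | rw [coeff_X_mul_reduced _ _ hij]
    simp only [mul_zero, neg_zero]

theorem IsNormalized.coeff_coeff_generatingBracket_of_size_le (hF : IsNormalized α F)
    (hf : f.natDegree ≤ 1) {K L : Kind} {i j : ℕ}
    (hij : K.size (F .B).natDegree ≤ i ∨ L.size (F .B).natDegree ≤ j) :
    ((generatingBracket f F K L).coeff i).coeff j = 0 := by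
  rw [coeff_coeff_generatingBracket, hF.coeff_coeff_upperBracket_of_size_le hf hij,
    hF.coeff_coeff_upperBracket_of_size_le hf hij.symm, sub_zero]

end Coefficients

/-! ### The brackets on the space of coefficients -/

section Coordinates

variable {n : ℕ} {α : ℂ}

/-- The generating functions in the variable `u = λ²` of the coordinates on the space of
coefficients. -/
def genPoly (n : ℕ) (α : ℂ) : Kind → (Coeffs n)[X]
  | .E => evenPart (polyA n α)
  | .O => oddPart (polyA n α)
  | .B => X ^ n + ∑ i : Fin n, C (.X (.B i)) * X ^ (i : ℕ)
  | .C => ∑ i : Fin n, C (.X (.C i)) * X ^ (i : ℕ)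

theorem polyB_eq_X_mul_expand : polyB n = X * expand (Coeffs n) 2 (genPoly n α .B) := by
  simp only [polyB, genPoly, map_add, map_sum, map_mul, map_pow, expand_C, expand_X, mul_add,
    Finset.mul_sum, pow_succ', pow_mul, mul_left_comm]

theorem polyC_eq_X_mul_expand : polyC n = X * expand (Coeffs n) 2 (genPoly n α .C) := by
  simp only [polyC, genPoly, map_sum, map_mul, map_pow, expand_C, expand_X, Finset.mul_sum,
    pow_succ', pow_mul, mul_left_comm]

theorem coeff_polyA_of_lt {i : ℕ} (hi : i < 2 * n + 1) :
    (polyA n α).coeff i = .X (.A ⟨i, hi⟩) := by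
  rw [polyA, coeff_add, coeff_C_mul_X_pow, if_neg hi.ne, coeff_sum_fin_C_mul_X_pow, dif_pos hi,
    zero_add]

theorem coeff_polyA_top : (polyA n α).coeff (2 * n + 1) = .C α := by
  rw [polyA, coeff_add, coeff_C_mul_X_pow, if_pos rfl, coeff_sum_fin_C_mul_X_pow,
    dif_neg (lt_irrefl _), add_zero]

theorem coeff_polyA_of_gt {i : ℕ} (hi : 2 * n + 1 < i) : (polyA n α).coeff i = 0 := by
  rw [polyA, coeff_add, coeff_C_mul_X_pow, if_neg hi.ne', coeff_sum_fin_C_mul_X_pow,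
    dif_neg hi.not_gt, add_zero]

theorem monic_genPoly_B : (genPoly n α .B).Monic :=
  monic_X_pow_add (degree_sum_fin_lt _)

theorem natDegree_genPoly_B : (genPoly n α .B).natDegree = n :=
  natDegree_eq_of_degree_eq_some <| by
    rw [genPoly, degree_add_eq_left_of_degree_lt] <;> simp [degree_sum_fin_lt]

theorem coeff_genPoly_C_of_le {i : ℕ} (hi : n ≤ i) : (genPoly n α .C).coeff i = 0 := by
  rw [genPoly, coeff_sum_fin_C_mul_X_pow, dif_neg hi.not_gt]

theorem isNormalized_genPoly : IsNormalized α (genPoly n α) where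
  monic_B := monic_genPoly_B
  natDegree_le K := by
    rw [natDegree_genPoly_B, natDegree_le_iff_coeff_eq_zero]
    intro i hi
    cases K with
    | E => rw [genPoly, coeff_evenPart, coeff_polyA_of_gt (by lia)]
    | O => rw [genPoly, coeff_oddPart, coeff_polyA_of_gt (by lia)]
    | B => exact coeff_eq_zero_of_natDegree_lt (natDegree_genPoly_B.trans_lt hi)
    | C => exact coeff_genPoly_C_of_le hi.le
  coeff_O := by rw [natDegree_genPoly_B, genPoly, coeff_oddPart, coeff_polyA_top]; rfl
  coeff_C := by rw [natDegree_genPoly_B, coeff_genPoly_C_of_le le_rfl]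

/-- The generating function in whose coefficients a coordinate occurs. -/
def Gen.kind : Gen n → Kind
  | .A i => if Even (i : ℕ) then .E else .O
  | .B _ => .B
  | .C _ => .C

/-- The degree in `u = λ²` of the term whose coefficient is a given coordinate. -/
def Gen.index : Gen n → ℕ
  | .A i => i / 2
  | .B i => i
  | .C i => i

theorem coeff_genPoly_kind_index (s : Gen n) : (genPoly n α s.kind).coeff s.index = .X s := by
  cases s with
  | A i =>
    rcases Nat.even_or_odd' (i : ℕ) with ⟨m, hm | hm⟩
    · have hi : Even (i : ℕ) := ⟨m, by lia⟩
      simp only [Gen.kind, Gen.index, if_pos hi, genPoly, coeff_evenPart,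
        Nat.two_mul_div_two_of_even hi]
      exact coeff_polyA_of_lt i.isLt
    · have hi : ¬Even (i : ℕ) := by grind
      simp only [Gen.kind, Gen.index, if_neg hi, genPoly, coeff_oddPart,
        Nat.two_mul_div_two_add_one_of_odd (Nat.not_even_iff_odd.1 hi)]
      exact coeff_polyA_of_lt i.isLt
  | B i =>
    simp only [Gen.kind, Gen.index, genPoly, coeff_add, coeff_X_pow, if_neg i.isLt.ne,
      coeff_sum_fin_C_mul_X_pow, dif_pos i.isLt, zero_add]
  | C i =>
    simp only [Gen.kind, Gen.index, genPoly, coeff_sum_fin_C_mul_X_pow, dif_pos i.isLt]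

theorem exists_gen_of_lt_size {K : Kind} {i : ℕ} (hi : i < K.size n) :
    ∃ s : Gen n, s.kind = K ∧ s.index = i := by
  cases K with
  | E => exact ⟨.A ⟨2 * i, by simp only [Kind.size] at hi; lia⟩, by simp [Gen.kind, Gen.index]⟩
  | O =>
    exact ⟨.A ⟨2 * i + 1, by simp only [Kind.size] at hi; lia⟩, by
      simp only [Gen.kind, Gen.index]; grind⟩
  | B => exact ⟨.B ⟨i, hi⟩, rfl, rfl⟩
  | C => exact ⟨.C ⟨i, hi⟩, rfl, rfl⟩

theorem exists_coeff_genPoly_eq_algebraMap {K : Kind} {i : ℕ} (hi : K.size n ≤ i) :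
    ∃ c : ℂ, (genPoly n α K).coeff i = algebraMap ℂ (Coeffs n) c := by
  cases K with
  | E =>
    have hi : n + 1 ≤ i := hi
    exact ⟨0, by rw [genPoly, coeff_evenPart, coeff_polyA_of_gt (by lia), map_zero]⟩
  | O =>
    rcases (show n ≤ i from hi).eq_or_lt with rfl | hi
    · exact ⟨α, by rw [genPoly, coeff_oddPart, coeff_polyA_top]; rfl⟩
    · exact ⟨0, by rw [genPoly, coeff_oddPart, coeff_polyA_of_gt (by lia), map_zero]⟩
  | B =>
    rcases (show n ≤ i from hi).eq_or_lt with rfl | hi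
    · have h := (monic_genPoly_B (n := n) (α := α)).coeff_natDegree
      rw [natDegree_genPoly_B] at h
      exact ⟨1, by rw [h, map_one]⟩
    · exact ⟨0, by
        rw [coeff_eq_zero_of_natDegree_lt (natDegree_genPoly_B.trans_lt hi), map_zero]⟩
  | C => exact ⟨0, by rw [coeff_genPoly_C_of_le (show n ≤ i from hi), map_zero]⟩

instance : Fintype (Gen n) :=
  .ofEquiv (Fin (2 * n + 1) ⊕ Fin n ⊕ Fin n)
    { toFun := Sum.elim .A (Sum.elim .B .C)
      invFun
        | .A i => .inl i
        | .B i => .inr (.inl i)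
        | .C i => .inr (.inr i)
      left_inv := by rintro (i | i | i) <;> rfl
      right_inv := by rintro (i | i | i) <;> rfl }

/-- The bracket which the linear polynomial `f` attaches to the generating functions of the
coordinates. -/
def pencilBracket (n : ℕ) (α : ℂ) (f : ℂ[X]) : Coeffs n →ₗ[ℂ] Coeffs n →ₗ[ℂ] Coeffs n :=
  biderivation fun s t : Gen n =>
    ((generatingBracket f (genPoly n α) s.kind t.kind).coeff s.index).coeff t.index

theorem isSkewBiderivation_pencilBracket (f : ℂ[X]) : IsSkewBiderivation (pencilBracket n α f) :=
  isSkewBiderivation_biderivation fun _ _ => coeff_coeff_generatingBracket_swap _ _ _ _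

theorem isPencilBracket_pencilBracket {f : ℂ[X]} (hf : f.natDegree ≤ 1) :
    IsPencilBracket f (genPoly n α) (pencilBracket n α f) := by
  have hb := isSkewBiderivation_pencilBracket (n := n) (α := α) f
  have coeff_zero {K L : Kind} {i j : ℕ} (hij : K.size n ≤ i ∨ L.size n ≤ j) :
      ((generatingBracket f (genPoly n α) K L).coeff i).coeff j = 0 :=
    isNormalized_genPoly.coeff_coeff_generatingBracket_of_size_le hf
      (by rwa [natDegree_genPoly_B])
  intro K L i j
  rcases le_or_gt (K.size n) i with hi | hi
  · obtain ⟨c, hc⟩ := exists_coeff_genPoly_eq_algebraMap (α := α) hi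
    rw [hc, hb.algebraMap_left, coeff_zero (.inl hi)]
  rcases le_or_gt (L.size n) j with hj | hj
  · obtain ⟨c, hc⟩ := exists_coeff_genPoly_eq_algebraMap (α := α) hj
    rw [hc, hb.map_algebraMap, coeff_zero (.inr hj)]
  obtain ⟨s, rfl, rfl⟩ := exists_gen_of_lt_size hi
  obtain ⟨t, rfl, rfl⟩ := exists_gen_of_lt_size hj
  rw [coeff_genPoly_kind_index, coeff_genPoly_kind_index, pencilBracket, biderivation_X_X]

theorem isPoissonBracket_pencilBracket {f : ℂ[X]} (hf : f.natDegree ≤ 1) :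
    IsPoissonBracket (pencilBracket n α f) :=
  have hb := isSkewBiderivation_pencilBracket f
  hb.isPoissonBracket_of_jacobiator_eval
    (fun s => ⟨s.kind, s.index, coeff_genPoly_kind_index s⟩)
    ((isPencilBracket_pencilBracket hf).jacobiator_eq_zero hb hf isNormalized_genPoly)

theorem pencilBracket_C_mul_add_C_mul (c d : ℂ) (f g : ℂ[X]) :
    pencilBracket n α (C c * f + C d * g) =
      c • pencilBracket n α f + d • pencilBracket n α g := by
  rw [pencilBracket, pencilBracket, pencilBracket, biderivation_smul_add_smul]
  congr 1
  funext s t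
  exact coeff_coeff_generatingBracket_C_mul_add_C_mul c d _ _ _ _

theorem areCompatible_pencilBracket {f g : ℂ[X]} (hf : f.natDegree ≤ 1) (hg : g.natDegree ≤ 1) :
    AreCompatible (pencilBracket n α f) (pencilBracket n α g) := fun c d => by
  rw [← pencilBracket_C_mul_add_C_mul]
  exact isPoissonBracket_pencilBracket <| natDegree_add_le_of_degree_le
    ((natDegree_C_mul_le _ _).trans hf) ((natDegree_C_mul_le _ _).trans hg)

theorem coeff_polyB_two_mul_add_one (i : ℕ) :
    (polyB n).coeff (2 * i + 1) = (genPoly n α .B).coeff i := by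
  rw [polyB_eq_X_mul_expand (α := α), coeff_X_mul, coeff_expand_mul' two_pos]

theorem coeff_polyB_two_mul (i : ℕ) : (polyB n).coeff (2 * i) = 0 := by
  rw [polyB_eq_X_mul_expand (α := 0)]
  cases i with
  | zero => exact coeff_X_mul_zero _
  | succ i => rw [mul_add_one, coeff_X_mul, coeff_expand two_pos, if_neg (by lia)]

theorem coeff_polyC_two_mul_add_one (i : ℕ) :
    (polyC n).coeff (2 * i + 1) = (genPoly n α .C).coeff i := by
  rw [polyC_eq_X_mul_expand (α := α), coeff_X_mul, coeff_expand_mul' two_pos]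

theorem monic_polyB : (polyB n).Monic := by
  rw [polyB_eq_X_mul_expand (α := 0)]
  exact monic_X.mul (monic_genPoly_B.expand two_pos)

theorem natDegree_polyB : (polyB n).natDegree = 2 * n + 1 := by
  rw [polyB_eq_X_mul_expand (α := 0), natDegree_X_mul, natDegree_expand, natDegree_genPoly_B,
    mul_comm]
  exact (monic_genPoly_B.expand two_pos).ne_zero

theorem at'_polyA (x : ℂ) :
    at' (polyA n α) x = (genPoly n α .E).eval (algebraMap ℂ _ (x ^ 2)) +
      x • (genPoly n α .O).eval (algebraMap ℂ _ (x ^ 2)) := by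
  rw [at', eval_eq_eval_evenPart_add_mul_eval_oddPart, map_pow, Algebra.smul_def]
  rfl

theorem at'_polyB (x : ℂ) :
    at' (polyB n) x = x • (genPoly n α .B).eval (algebraMap ℂ _ (x ^ 2)) := by
  rw [at', polyB_eq_X_mul_expand (α := α), eval_mul, eval_X, expand_eval, map_pow,
    Algebra.smul_def]

theorem at'_polyC (x : ℂ) :
    at' (polyC n) x = x • (genPoly n α .C).eval (algebraMap ℂ _ (x ^ 2)) := by
  rw [at', polyC_eq_X_mul_expand (α := α), eval_mul, eval_X, expand_eval, map_pow,
    Algebra.smul_def]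

theorem at'_polyB_neg (x : ℂ) : at' (polyB n) (-x) = -at' (polyB n) x := by
  rw [at'_polyB (α := 0), at'_polyB (α := 0), neg_sq, neg_smul]

theorem at'_polyC_neg (x : ℂ) : at' (polyC n) (-x) = -at' (polyC n) x := by
  rw [at'_polyC (α := 0), at'_polyC (α := 0), neg_sq, neg_smul]

theorem polyRho_eq_of_coeff {k : ℕ} {q : (Coeffs n)[X]}
    (h : ∀ i, 2 * n + 2 ≤ i → (X ^ (2 * k) * polyA n α).coeff i = (X * polyB n * q).coeff i) :
    polyRho n α k = q := by
  have monic_X_mul_polyB := monic_X.mul (monic_polyB (n := n))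
  refine (div_modByMonic_unique q (X ^ (2 * k) * polyA n α - X * polyB n * q) monic_X_mul_polyB
    ⟨by ring, ?_⟩).1
  rw [degree_eq_natDegree monic_X_mul_polyB.ne_zero, natDegree_X_mul monic_polyB.ne_zero,
    natDegree_polyB, degree_lt_iff_coeff_zero]
  intro i hi
  rw [coeff_sub, h i hi, sub_self]

variable (n α) in
theorem polyRho_zero : polyRho n α 0 = 0 :=
  polyRho_eq_of_coeff fun i hi => by
    rw [mul_zero, pow_zero, one_mul, mul_zero, coeff_zero, coeff_polyA_of_gt hi]

variable (n α) in
theorem polyRho_one :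
    polyRho n α 1 = C (MvPolynomial.C α) * X + C (MvPolynomial.X (.A (Fin.last (2 * n)))) :=
  polyRho_eq_of_coeff fun i hi => by
    obtain ⟨i, rfl⟩ := Nat.exists_eq_add_of_le' (le_of_add_le_right hi)
    have coeff_polyB_top : (polyB n).coeff (2 * n + 1) = 1 := by
      rw [← natDegree_polyB, monic_polyB.coeff_natDegree]
    have coeff_polyB_of_gt {j} (hj : 2 * n + 1 < j) : (polyB n).coeff j = 0 :=
      coeff_eq_zero_of_natDegree_lt (natDegree_polyB.trans_lt hj)
    have coeff_mul (c d : Coeffs n) : (X * polyB n * (C c * X + C d)).coeff (i + 2) =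
        c * (polyB n).coeff i + d * (polyB n).coeff (i + 1) := by
      rw [mul_assoc, coeff_X_mul, mul_add, mul_left_comm, mul_comm _ X, coeff_add, coeff_C_mul,
        coeff_X_mul, coeff_mul_C, mul_comm (coeff _ _)]
    rw [mul_one, coeff_X_pow_mul, coeff_mul]
    rcases (show 2 * n ≤ i by lia).eq_or_lt with rfl | hi
    · rw [coeff_polyA_of_lt (Nat.lt_succ_self _), coeff_polyB_two_mul, coeff_polyB_top, mul_zero,
        mul_one, zero_add]
      rfl
    rcases (show 2 * n + 1 ≤ i from hi).eq_or_lt with rfl | hi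
    · rw [coeff_polyA_top, coeff_polyB_top, coeff_polyB_of_gt (Nat.lt_succ_self _), mul_zero,
        mul_one, add_zero]
    · rw [coeff_polyA_of_gt hi, coeff_polyB_of_gt hi, coeff_polyB_of_gt (hi.trans i.lt_succ_self),
        mul_zero, mul_zero, add_zero]

end Coordinates

/-! ### The relations of the family -/

section Family

variable {n k : ℕ} {α : ℂ} {b b' : Coeffs n →ₗ[ℂ] Coeffs n →ₗ[ℂ] Coeffs n}

theorem skewBiderivation_ext_at' (hb : IsSkewBiderivation b) (hb' : IsSkewBiderivation b')
    (h : ∀ x y : ℂ, x - y ≠ 0 → x + y ≠ 0 → ∀ i j : Fin 3, i ≤ j →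
      b (at' (![polyA n α, polyB n, polyC n] i) x) (at' (![polyA n α, polyB n, polyC n] j) y) =
        b' (at' (![polyA n α, polyB n, polyC n] i) x)
          (at' (![polyA n α, polyB n, polyC n] j) y)) :
    b = b' := by
  refine hb.ext_of_eventually hb' (P := ![polyA n α, polyB n, polyC n]) ?_ fun i j x => ?_
  · rintro (i | i | i)
    · exact ⟨0, i, coeff_polyA_of_lt i.isLt⟩
    · exact ⟨1, 2 * i + 1, (coeff_polyB_two_mul_add_one (α := α) _).trans
        (coeff_genPoly_kind_index (.B i))⟩
    · exact ⟨2, 2 * i + 1, (coeff_polyC_two_mul_add_one (α := α) _).trans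
        (coeff_genPoly_kind_index (.C i))⟩
  · filter_upwards [(Set.finite_singleton x).compl_mem_cofinite,
      (Set.finite_singleton (-x)).compl_mem_cofinite] with y hy hy'
    have hsub : x - y ≠ 0 := sub_ne_zero.2 fun h => hy h.symm
    have hadd : x + y ≠ 0 := fun h => hy' (eq_neg_of_add_eq_zero_right h)
    rcases le_total i j with hij | hij
    · exact h x y hsub hadd i j hij
    · rw [hb.skew, hb'.skew]
      exact congrArg Neg.neg (h y x (by rwa [← neg_sub, neg_ne_zero]) (by rwa [add_comm]) j i hij)

theorem SatisfiesFamilyRelations.eq {η : ℂ} (h : SatisfiesFamilyRelations n η α k b)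
    (h' : SatisfiesFamilyRelations n η α k b') (hb : IsSkewBiderivation b)
    (hb' : IsSkewBiderivation b') : b = b' := by
  refine skewBiderivation_ext_at' (α := α) hb hb' fun x y hsub hadd i j hij => ?_
  fin_cases i <;> fin_cases j <;> first | exact absurd hij (by decide) | skip
  · exact (h.AA x y hsub hadd).trans (h'.AA x y hsub hadd).symm
  · exact (h.AB x y hsub hadd).trans (h'.AB x y hsub hadd).symm
  · exact (h.AC x y hsub hadd).trans (h'.AC x y hsub hadd).symm
  · exact (h.BB x y hsub hadd).trans (h'.BB x y hsub hadd).symm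
  · exact (h.BC x y hsub hadd).trans (h'.BC x y hsub hadd).symm
  · exact (h.CC x y hsub hadd).trans (h'.CC x y hsub hadd).symm

theorem at'_polyRho (hk : k ≤ 1) (x : ℂ) :
    at' (polyRho n α k) x = (k : ℂ) • (algebraMap ℂ _ (α * x) + (genPoly n α .E).coeff n) := by
  interval_cases k
  · rw [polyRho_zero, at', eval_zero, Nat.cast_zero, zero_smul]
  · rw [polyRho_one, at', Nat.cast_one, one_smul, eval_add, eval_mul, eval_C, eval_C, eval_X,
      map_mul, genPoly, coeff_evenPart, coeff_polyA_of_lt (Nat.lt_succ_self _)]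
    rfl

theorem algebraMap_inv_add_mul {R : Type*} [CommRing R] [Algebra ℂ R] {x y : ℂ}
    (hadd : x + y ≠ 0) :
    algebraMap ℂ R (x + y)⁻¹ * (algebraMap ℂ R x + algebraMap ℂ R y) = 1 := by
  rw [← map_add, ← map_mul, inv_mul_cancel₀ hadd, map_one]

set_option maxHeartbeats 400000 in
-- The last step checks a rational identity for each of the six relations.
theorem satisfiesFamilyRelations_pencilBracket (η : ℂ) (hk : k ≤ 1) :
    SatisfiesFamilyRelations n η α k (pencilBracket n α (C η * X ^ k)) := by
  have hf : (C η * X ^ k).natDegree ≤ 1 := (natDegree_C_mul_X_pow_le _ _).trans hk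
  have H := isPencilBracket_pencilBracket (n := n) (α := α) hf
  have hF := isNormalized_genPoly (n := n) (α := α)
  have coeff_B := hF.monic_B.coeff_natDegree
  have coeff_O := hF.coeff_O
  have coeff_C := hF.coeff_C
  have reduced_eval := hF.evalEval_reduced hf
  rw [natDegree_genPoly_B] at coeff_B coeff_O coeff_C
  have inv_sq (x y : ℂ) : (x ^ 2 - y ^ 2)⁻¹ = (x - y)⁻¹ * (x + y)⁻¹ := by
    rw [sq_sub_sq, mul_inv_rev]
  have inv_sq_swap (x y : ℂ) : (y ^ 2 - x ^ 2)⁻¹ = -((x - y)⁻¹ * (x + y)⁻¹) := by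
    rw [← inv_sq, ← inv_neg, neg_sub]
  -- This treats `k = 0` and `k = 1` simultaneously.
  have pow_eq (z : ℂ) : z ^ k = 1 - k + k * z := by interval_cases k <;> norm_num
  have coeff_f : (C η * X ^ k).coeff 1 = η * k := by
    interval_cases k <;> simp
  constructor
  all_goals
    intro x y hsub hadd
    have hxy : x ^ 2 ≠ y ^ 2 := sub_ne_zero.1 (sq_sub_sq x y ▸ mul_ne_zero hadd hsub)
    have inv_sub := algebraMap_inv_sub_mul (R := Coeffs n) (sub_ne_zero.1 hsub)
    have inv_add := algebraMap_inv_add_mul (R := Coeffs n) hadd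
    simp only [at'_polyA, at'_polyB (α := α), at'_polyC (α := α), at'_polyRho hk, map_add,
      map_smul, LinearMap.add_apply, LinearMap.smul_apply, H.apply_eval, upperBracket, evalEval_neg,
      evalEval_mul, evalEval_C, evalEval_X, evalEval_map_C, evalEval_zero, eval_C, eval_ofNat,
      reduced_eval _ _ hxy, reduced_eval _ _ hxy.symm, leadingCross, natDegree_genPoly_B, coeff_B,
      coeff_O, coeff_C, eval_mul, eval_sub, eval_pow, eval_X, coeff_f, neg_sq, pow_mul, pow_eq,
      inv_sq x y, inv_sq_swap x y, div_eq_mul_inv]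
    simp only [Algebra.smul_def, map_add, map_sub, map_mul, map_neg, map_pow, map_ofNat, map_one,
      map_natCast] at inv_sub inv_add ⊢
    grind

end Family

/-! ### The reflection equation -/

section ReflectionEquation

variable {n : ℕ} {α : ℂ} {b : Coeffs n →ₗ[ℂ] Coeffs n →ₗ[ℂ] Coeffs n}

theorem permMatrix_eq_submatrix_one : permMatrix n = Matrix.submatrix 1 Prod.swap id := by
  ext p q
  simp only [permMatrix, Matrix.of_apply, Matrix.submatrix_apply, Matrix.one_apply, Prod.ext_iff,
    Prod.fst_swap, Prod.snd_swap, id_eq, and_comm]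

theorem permMatrix_mul (M : Matrix (Fin 2 × Fin 2) (Fin 2 × Fin 2) (Coeffs n)) :
    permMatrix n * M = M.submatrix Prod.swap id := by
  rw [permMatrix_eq_submatrix_one]
  exact Matrix.one_submatrix_mul _ (.refl _) M

theorem mul_permMatrix (M : Matrix (Fin 2 × Fin 2) (Fin 2 × Fin 2) (Coeffs n)) :
    M * permMatrix n = M.submatrix id Prod.swap := by
  rw [permMatrix_eq_submatrix_one]
  exact Matrix.mul_submatrix_one (Equiv.prodComm _ _) id M

theorem kronecker_mul_permMatrix (M N : Matrix (Fin 2) (Fin 2) (Coeffs n)) :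
    (M ⊗ₖ N) * permMatrix n = permMatrix n * (N ⊗ₖ M) := by
  rw [permMatrix_mul, mul_permMatrix]
  ext p q : 1
  exact mul_comm (M p.1 q.2) (N p.2 q.1)

theorem reflectionEquation_rhs_eq_permMatrix_mul (η x y : ℂ) :
    (rMatrix n η (x - y) * (T₁ n α x * T₂ n α y) - (T₁ n α x * T₂ n α y) * rMatrix n η (x - y)) +
        T₁ n α x * rMatrix n η (x + y) * T₂ n α y - T₂ n α y * rMatrix n η (x + y) * T₁ n α x =
      permMatrix n * ((-η / (x - y)) • (T n α x ⊗ₖ T n α y - T n α y ⊗ₖ T n α x) +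
        (-η / (x + y)) • (1 ⊗ₖ (T n α x * T n α y) - (T n α y * T n α x) ⊗ₖ 1)) := by
  simp only [rMatrix, T₁, T₂, Matrix.smul_mul, Matrix.mul_smul, kronecker_mul_permMatrix,
    Matrix.mul_assoc, ← Matrix.mul_kronecker_mul, Matrix.mul_one, Matrix.one_mul, Matrix.mul_add,
    Matrix.mul_sub, smul_sub]
  abel

theorem satisfiesReflectionEquation_iff {η : ℂ} :
    SatisfiesReflectionEquation n η α b ↔ ∀ x y : ℂ, x - y ≠ 0 → x + y ≠ 0 → ∀ i j k l,
      b (T n α x i j) (T n α y k l) =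
        (-η / (x - y)) • (T n α x k j * T n α y i l - T n α y k j * T n α x i l) +
          (-η / (x + y)) •
            ((1 : Matrix (Fin 2) (Fin 2) (Coeffs n)) k j * (T n α x * T n α y) i l -
              (T n α y * T n α x) k j * (1 : Matrix (Fin 2) (Fin 2) (Coeffs n)) i l) := by
  refine forall₄_congr fun x y _ _ => ?_
  rw [reflectionEquation_rhs_eq_permMatrix_mul, permMatrix_mul, ← Matrix.ext_iff]
  exact ⟨fun h i j k l => h (i, k) (j, l), fun h p q => h p.1 q.1 p.2 q.2⟩

theorem SatisfiesReflectionEquation.satisfiesFamilyRelations {η : ℂ}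
    (h : SatisfiesReflectionEquation n (-η) α b) : SatisfiesFamilyRelations n η α 0 b := by
  constructor <;> intro x y hsub hadd <;>
    have entry := satisfiesReflectionEquation_iff.1 h x y hsub hadd
  case' AA => specialize entry 0 0 0 0
  case' AB => specialize entry 0 0 0 1
  case' AC => specialize entry 0 0 1 0
  case' BB => specialize entry 0 1 0 1
  case' BC => specialize entry 0 1 1 0
  case' CC => specialize entry 1 0 1 0
  all_goals
    simp only [T, Matrix.of_apply, Matrix.cons_val', Matrix.cons_val_zero, Matrix.cons_val_one,
      Matrix.cons_val_fin_one, Matrix.mul_apply, Fin.sum_univ_two, Matrix.one_apply_eq,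
      Matrix.one_apply_ne, ne_eq, zero_ne_one, one_ne_zero, not_false_eq_true, Fin.isValue,
      at'_polyRho zero_le_one, Nat.cast_zero, Algebra.smul_def, div_eq_mul_inv, map_mul, map_neg,
      map_zero, pow_zero, mul_zero, map_one] at entry ⊢
    linear_combination entry

theorem SatisfiesFamilyRelations.satisfiesReflectionEquation {η : ℂ} (hb : IsSkewBiderivation b)
    (h : SatisfiesFamilyRelations n η α 0 b) : SatisfiesReflectionEquation n (-η) α b := by
  refine satisfiesReflectionEquation_iff.2 fun x y hsub hadd i j k l => ?_
  have neg_sub_eq (z w : ℂ) : -z - w = -(z + w) := by ring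
  have inv_swap : (y - x)⁻¹ = -(x - y)⁻¹ := by rw [← inv_neg, neg_sub]
  have skew_BA := fun z w => hb.skew (at' (polyB n) z) (at' (polyA n α) w)
  have skew_CA := fun z w => hb.skew (at' (polyC n) z) (at' (polyA n α) w)
  have skew_CB := fun z w => hb.skew (at' (polyC n) z) (at' (polyB n) w)
  fin_cases i <;> fin_cases j <;> fin_cases k <;> fin_cases l
  all_goals
    simp (disch := grind) only [T, Matrix.of_apply, Matrix.cons_val', Matrix.cons_val_zero,
      Matrix.cons_val_one, Matrix.cons_val_fin_one, Matrix.mul_apply, Fin.sum_univ_two,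
      Matrix.one_apply_eq, Matrix.one_apply_ne, Fin.isValue, Fin.zero_eta, Fin.mk_one, neg_neg,
      at'_polyRho zero_le_one, at'_polyB_neg, at'_polyC_neg, skew_BA, skew_CA, skew_CB, h.AA, h.AB,
      h.AC, h.BB, h.BC, h.CC]
    simp only [← sub_eq_add_neg, neg_add_eq_sub, neg_sub_eq, inv_swap, add_comm y x, inv_neg,
      Nat.cast_zero, Algebra.smul_def, div_eq_mul_inv, map_mul, map_neg, map_zero, map_one,
      pow_zero, mul_zero]
    ring

end ReflectionEquation

end ReflectionAlgebra

end

open Polynomial ReflectionAlgebra in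
/-- For `k = 0, 1` the relations of the family define one and only one bracket `P k` on the
algebra of functions of the coefficients of `T(λ)`; `P 0`, `P 1` are compatible Poisson brackets,
and `P 0` is the bracket of the rational reflection equation algebra with
`r(λ) = (η / λ) Π` (that is, with `-η` in place of `η` in `r(λ) = (-η / λ) Π`). -/
theorem proposition1 (n : ℕ) (η α : ℂ) :
    polyRho n α 0 = 0 ∧
    polyRho n α 1 =
      C (MvPolynomial.C α) * X + C (MvPolynomial.X (Gen.A (Fin.last (2 * n)))) ∧
    ∃ P : Fin 2 → (Coeffs n →ₗ[ℂ] Coeffs n →ₗ[ℂ] Coeffs n),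
      (∀ (k : Fin 2) (b : Coeffs n →ₗ[ℂ] Coeffs n →ₗ[ℂ] Coeffs n),
        (IsSkewBiderivation b ∧ SatisfiesFamilyRelations n η α (k : ℕ) b) ↔ b = P k) ∧
      (∀ k : Fin 2, IsPoissonBracket (P k)) ∧
      (∀ b : Coeffs n →ₗ[ℂ] Coeffs n →ₗ[ℂ] Coeffs n,
        (IsSkewBiderivation b ∧ SatisfiesReflectionEquation n (-η) α b) ↔ b = P 0) ∧
      AreCompatible (P 0) (P 1) := by
  have hf (k : Fin 2) : (C η * X ^ (k : ℕ)).natDegree ≤ 1 :=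
    (natDegree_C_mul_X_pow_le _ _).trans k.is_le
  have hb (k : Fin 2) := isSkewBiderivation_pencilBracket (n := n) (α := α) (C η * X ^ (k : ℕ))
  have hrel (k : Fin 2) := satisfiesFamilyRelations_pencilBracket (n := n) (α := α) η k.is_le
  refine ⟨polyRho_zero n α, polyRho_one n α, fun k => pencilBracket n α (C η * X ^ (k : ℕ)),
    fun k b => ⟨fun h => h.2.eq (hrel k) h.1 (hb k), ?_⟩,
    fun k => isPoissonBracket_pencilBracket (hf k),
    fun b => ⟨fun h => h.2.satisfiesFamilyRelations.eq (hrel 0) h.1 (hb 0), ?_⟩,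
    areCompatible_pencilBracket (hf 0) (hf 1)⟩
  · rintro rfl
    exact ⟨hb k, hrel k⟩
  · rintro rfl
    exact ⟨hb 0, (hrel 0).satisfiesReflectionEquation (hb 0)⟩
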